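/- Let $d\ge 0$ be an integer and let $\alpha=(\alpha_1,\dots,\alpha_{d+1})\in\mathbb R^{d+1}$ be strictly increasing, $\alpha_1<\alpha_2<\dots<\alpha_{d+1}$. Write $[d+1]=\{1,\dots,d+1\}$, $\bm e_S=\sum_{i\in S}\bm e_i$ for $S\subseteq[d+1]$, $\langle\cdot,\cdot\rangle$ for the dot product, and $$U_d^\alpha=\Big\{\mathbf x\in\mathbb R^{d+1} : \sum_{i=1}^{d+1}x_i=\sum_{i=1}^{d+1}\alpha_i\Big\}.$$ For a complete binary tree $T$ (a plane rooted tree in which every internal vertex has exactly two children, a left one and a right one) with $d+1$ internal vertices, number its $d+2$ leaves $\ell_1,\dots,\ell_{d+2}$ from left to right, and for $1\le i\le d+1$ let $T_{(i)}$ be the subtree of $T$ rooted at the closest common ancestor of $\ell_i$ and $\ell_{i+1}$. Let $v_T^\alpha\in\mathbb R^{d+1}$ be the point whose $i$-th coordinate is $$\sum_{k=1}^{t}\alpha_k-\sum_{k=1}^{a}\alpha_k-\sum_{k=1}^{b}\alpha_k,$$ where $t$, $a$, $b$ are the numbers of internal vertices of $T_{(i)}$, of its left subtree and of its right subtree, respectively.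 Let $\mathrm{LodAsso}(\alpha)$ be the convex hull of the points $v_T^\alpha$, where $T$ ranges over all complete binary trees with $d+1$ internal vertices. Let $\mathscr I_d$ be the set of all integer intervals $I$ with $\emptyset\ne I\subsetneq[d+1]$, and write $\bar I=[d+1]\setminus I$. Then $$\mathrm{LodAsso}(\alpha)=\Big\{\mathbf x\in U_d^\alpha : \langle \bm e_{\bar I},\mathbf x\rangle\le\sum_{i=|I|+1}^{d+1}\alpha_i\ \text{ for all } I\in\mathscr I_d\Big\},$$ and this inequality description is minimal: $\mathrm{LodAsso}(\alpha)$ has exactly $|\mathscr I_d|$ facets, and $$I\mapsto\Big\{\mathbf x\in\mathrm{LodAsso}(\alpha) : \langle \bm e_{\bar I},\mathbf x\rangle=\sum_{i=|I|+1}^{d+1}\alpha_i\Big\}$$ is a bijection from $\mathscr I_d$ onto the set of facets of $\mathrm{LodAsso}(\alpha)$. Here a facet of a polytope $P$ is a nonempty face of $P$ of dimension $\dim P-1$, a nonempty face being the set of points of $P$ at which some linear functional attains its maximum over $P$. -/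

import Mathlib

/-! ## Polyhedra, faces, facets and minimal inequality descriptions -/

section Polyhedra

variable {n : ℕ}

/-- The dimension of a nonempty convex set `P`: the dimension of its affine span. -/
noncomputable def polyDim (P : Set (Fin n → ℝ)) : ℕ :=
  Module.finrank ℝ (vectorSpan ℝ P)

/-- `F` is a facet of `P`: a nonempty face of dimension `dim P - 1`.
A face is a set of maximizers over `P` of a linear functional, which is Mathlib's `IsExposed`
(under which the empty set also counts as a face; it has dimension `-1`
and is not regarded as a facet). -/
def IsFacet (P F : Set (Fin n → ℝ)) : Prop :=
  IsExposed ℝ P F ∧ F.Nonempty ∧ polyDim F + 1 = polyDim P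

/-- The solution set in `U` of the inequalities `⟨a i, x⟩ ≤ b i`. -/
def ineqSolutions {ι : Type} (U : Set (Fin n → ℝ)) (a : ι → Fin n → ℝ) (b : ι → ℝ) :
    Set (Fin n → ℝ) :=
  {x | x ∈ U ∧ ∀ i, a i ⬝ᵥ x ≤ b i}

/-- The finite system `⟨a i, x⟩ ≤ b i`, `i : ι`, is a minimal inequality description of `P` in
`U`: it defines `P`, the number of facets of `P` is the number of inequalities, and turning
the inequalities into equalities gives every facet of `P` exactly once. -/
structure IsMinimalIneqDescription {ι : Type} [Finite ι] (P U : Set (Fin n → ℝ))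
    (a : ι → Fin n → ℝ) (b : ι → ℝ) : Prop where
  eq_solutions : P = ineqSolutions U a b
  ncard_facets : {F | IsFacet P F}.ncard = Nat.card ι
  bijOn_facets : Set.BijOn (fun i => {x | x ∈ P ∧ a i ⬝ᵥ x = b i}) Set.univ {F | IsFacet P F}

end Polyhedra

/-! ## Complete binary trees and the Loday associahedron

A complete binary tree is a `BinaryTree Unit`: `nil` is a leaf, and each `node` is an internal
vertex with its left and right subtrees. A vector `α = (α_1, …, α_n)` is a function on `Fin n`,
with `α_k` being the value at the element `k - 1`. -/

section Loday

/-- The subtree of `T` rooted at the internal vertex labeled by `i`, which is the closest common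
ancestor of the leaves number `i` and `i + 1`, the leaves being numbered `1, 2, …` from left to
right (for `1 ≤ i ≤ T.numNodes`). -/
def subtreeAt : BinaryTree Unit → ℕ → BinaryTree Unit
  | .nil, _ => .nil
  | .node u l r, i =>
    if i + 1 ≤ l.numLeaves then
      -- both leaves lie in the left subtree
      subtreeAt l i
    else if l.numLeaves < i then
      -- both leaves lie in the right subtree
      subtreeAt r (i - l.numLeaves)
    else
      -- the two leaves are separated by the root
      .node u l r

variable {n : ℕ}

/-- The partial sum `∑_{k=1}^t α_k`. -/
def partialSum (α : Fin n → ℝ) (t : ℕ) : ℝ :=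
  ∑ k : Fin n with k.val < t, α k

/-- `val(α, T) = ∑_{k=1}^t α_k - ∑_{k=1}^a α_k - ∑_{k=1}^b α_k`, where `t`, `a`, `b` are the
numbers of internal vertices of `T`, of its left subtree and of its right subtree. -/
def treeVal (α : Fin n → ℝ) (T : BinaryTree Unit) : ℝ :=
  partialSum α T.numNodes - partialSum α T.left.numNodes - partialSum α T.right.numNodes

/-- The point `v_T^α`, whose coordinate number `i` (the element `i - 1` of `Fin n`) is the value of
the subtree rooted at the internal vertex labeled by `i`. -/
def lodayVertex (α : Fin n → ℝ) (T : BinaryTree Unit) : Fin n → ℝ :=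
  fun i => treeVal α (subtreeAt T (i.val + 1))

/-- The Loday associahedron: the convex hull of the points `v_T^α` over all complete binary trees
`T` with `n` internal vertices. -/
def LodAsso (α : Fin n → ℝ) : Set (Fin n → ℝ) :=
  convexHull ℝ {v | ∃ T : BinaryTree Unit, T.numNodes = n ∧ v = lodayVertex α T}

/-- The affine hyperplane of vectors with the same coordinate sum as `α`. -/
def sumHyperplane (α : Fin n → ℝ) : Set (Fin n → ℝ) :=
  {x | (1 : Fin n → ℝ) ⬝ᵥ x = ∑ i, α i}

/-- `e_S = ∑_{i ∈ S} e_i`. -/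
def indicatorVec (S : Finset (Fin n)) : Fin n → ℝ :=
  ∑ i ∈ S, Pi.single i 1

/-- The nonempty proper integer intervals of the index set. -/
abbrev ProperInterval (n : ℕ) : Type :=
  {I : Finset (Fin n) // (∃ a b : Fin n, I = Finset.Icc a b) ∧ I.Nonempty ∧ I ≠ Finset.univ}

end Loday

/-!
Summation over the complement turns the inequality of `I` into a lower bound, by the partial sum
`∑_{k ≤ |I|} α_k`, for the sum of the coordinates in `I`.

The tree points satisfy these bounds because the partial sums of an increasing sequence are
supermodular. Conversely, given a point `x` that satisfies them and a cost vector `c`, put the root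
of a tree at an entry where `c` is minimal and recurse on both sides: the resulting tree point costs
at most as much as `x`, so no hyperplane separates `x` from the convex hull.

An inequality description is minimal as soon as there is a point at which all inequalities are
strict and, for each inequality, a point at which it is the only tight one. Such points are
`α` averaged over all entries, and `α` averaged separately over its first `|I|` entries, placed
on `I`, and over the others, placed on the complement of `I`.
-/

/-! ### Facets of polyhedra -/

section Polyhedron

variable {E ι : Type*} [AddCommGroup E] [Module ℝ E]

/-- The level set `l x = c` of a linear functional as an affine subspace: a hyperplane
if `l ≠ 0`. -/
def levelSubspace (l : Module.Dual ℝ E) (c : ℝ) : AffineSubspace ℝ E where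
  carrier := {x | l x = c}
  smul_vsub_vadd_mem' r x y z hx hy hz := by
    simp_all

@[simp] lemma mem_levelSubspace {l : Module.Dual ℝ E} {c : ℝ} {x : E} :
    x ∈ levelSubspace l c ↔ l x = c := Iff.rfl

lemma direction_levelSubspace {l : Module.Dual ℝ E} {c : ℝ} {x : E} (hx : l x = c) :
    (levelSubspace l c).direction = LinearMap.ker l := by
  ext w
  rw [← AffineSubspace.vadd_mem_iff_mem_direction w (mem_levelSubspace.2 hx)]
  simp [hx]

/-- The polyhedron of the solutions in the affine subspace `U` of the inequalities
`f i x ≤ b i`. It is `ineqSolutions` without coordinates. -/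
def polyhedron (U : AffineSubspace ℝ E) (f : ι → Module.Dual ℝ E) (b : ι → ℝ) : Set E :=
  {x | x ∈ U ∧ ∀ i, f i x ≤ b i}

/-- The face of a polyhedron on which its inequality number `i` is tight. -/
def tightFace (U : AffineSubspace ℝ E) (f : ι → Module.Dual ℝ E) (b : ι → ℝ) (i : ι) : Set E :=
  {x | x ∈ polyhedron U f b ∧ f i x = b i}

variable {U : AffineSubspace ℝ E} {f : ι → Module.Dual ℝ E} {b : ι → ℝ} {x : E} {i : ι}

lemma convex_polyhedron : Convex ℝ (polyhedron U f b) := by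
  have : polyhedron U f b = (U : Set E) ∩ ⋂ i, {x | f i x ≤ b i} := by ext; simp [polyhedron]
  rw [this]
  exact U.convex.inter (convex_iInter fun i => convex_halfSpace_le (f i).isLinear (b i))

lemma tightFace_eq_polyhedron : tightFace U f b i =
    polyhedron (U ⊓ levelSubspace (f i) (b i)) (fun j : {j // j ≠ i} => f j) (fun j => b j) := by
  ext x
  simp only [tightFace, polyhedron, Set.mem_ofPred_eq, AffineSubspace.mem_inf_iff,
    mem_levelSubspace, Subtype.forall]
  refine ⟨fun ⟨⟨hU, hle⟩, heq⟩ => ⟨⟨hU, heq⟩, fun j _ => hle j⟩,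
    fun ⟨⟨hU, heq⟩, hle⟩ => ⟨⟨hU, fun j => ?_⟩, heq⟩⟩
  obtain rfl | hj := eq_or_ne j i
  exacts [heq.le, hle j hj]

lemma mem_tightFace (hx : x ∈ U) (heq : f i x = b i) (hlt : ∀ j ≠ i, f j x < b j) :
    x ∈ tightFace U f b i := by
  rw [tightFace_eq_polyhedron]
  exact ⟨⟨hx, heq⟩, fun j => (hlt j j.2).le⟩

lemma exists_pos_add_smul_mem_polyhedron [Finite ι] (hx : x ∈ U) (hlt : ∀ i, f i x < b i) {w : E}
    (hw : w ∈ U.direction) : ∃ ε > (0 : ℝ), x + ε • w ∈ polyhedron U f b := by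
  have hnear : ∀ i, ∀ᶠ ε : ℝ in nhdsWithin 0 (Set.Ioi 0), f i x + ε * f i w < b i := fun i => by
    have hcont : Continuous fun ε : ℝ => f i x + ε * f i w := by fun_prop
    exact (hcont.tendsto' 0 (f i x) (by simp)).mono_left nhdsWithin_le_nhds
      |>.eventually_lt_const (hlt i)
  obtain ⟨ε, hε, hpos⟩ := ((Filter.eventually_all.2 hnear).and self_mem_nhdsWithin).exists
  refine ⟨ε, hpos, ?_, fun i => by simpa using (hε i).le⟩
  rw [add_comm]
  exact AffineSubspace.vadd_mem_of_mem_direction (U.direction.smul_mem ε hw) hx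

lemma vectorSpan_polyhedron [Finite ι] (hx : x ∈ U) (hlt : ∀ i, f i x < b i) :
    vectorSpan ℝ (polyhedron U f b) = U.direction := by
  refine le_antisymm (vectorSpan_mono ℝ fun y hy => hy.1) fun w hw => ?_
  obtain ⟨ε, hε, hmem⟩ := exists_pos_add_smul_mem_polyhedron hx hlt hw
  have hsmul := vsub_mem_vectorSpan ℝ hmem ⟨hx, fun i => (hlt i).le⟩
  rw [vsub_eq_sub, add_sub_cancel_left] at hsmul
  exact (Submodule.smul_mem_iff _ hε.ne').1 hsmul

lemma vectorSpan_tightFace [Finite ι] (hx : x ∈ U) (heq : f i x = b i)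
    (hlt : ∀ j ≠ i, f j x < b j) :
    vectorSpan ℝ (tightFace U f b i) = U.direction ⊓ LinearMap.ker (f i) := by
  have hmem : x ∈ U ⊓ levelSubspace (f i) (b i) := ⟨hx, heq⟩
  rw [tightFace_eq_polyhedron, vectorSpan_polyhedron hmem fun j : {j // j ≠ i} => hlt j j.2,
    AffineSubspace.direction_inf_of_mem hx (mem_levelSubspace.2 heq), direction_levelSubspace heq]

lemma finrank_inf_ker_add_one {V : Submodule ℝ E} [FiniteDimensional ℝ V] {l : Module.Dual ℝ E}
    {w : E} (hw : w ∈ V) (hlw : l w ≠ 0) :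
    Module.finrank ℝ ↥(V ⊓ LinearMap.ker l) + 1 = Module.finrank ℝ V := by
  have hl : l.domRestrict V ≠ 0 := fun h => hlw (LinearMap.congr_fun h ⟨w, hw⟩)
  have hmap : V ⊓ LinearMap.ker l = (LinearMap.ker (l.domRestrict V)).map V.subtype := by
    ext y
    simp [and_comm]
  rw [hmap, Submodule.finrank_map_subtype_eq, Module.Dual.finrank_ker_add_one_of_ne_zero hl]

lemma finrank_vectorSpan_tightFace_add_one [Finite ι] [FiniteDimensional ℝ E] {x₀ : E}
    (hx₀ : x₀ ∈ U) (hlt₀ : ∀ i, f i x₀ < b i) (hx : x ∈ U) (heq : f i x = b i)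
    (hlt : ∀ j ≠ i, f j x < b j) :
    Module.finrank ℝ (vectorSpan ℝ (tightFace U f b i)) + 1 =
      Module.finrank ℝ (vectorSpan ℝ (polyhedron U f b)) := by
  rw [vectorSpan_polyhedron hx₀ hlt₀, vectorSpan_tightFace hx heq hlt]
  refine finrank_inf_ker_add_one (AffineSubspace.vsub_mem_direction hx₀ hx) ?_
  rw [vsub_eq_sub, map_sub, heq]
  exact (sub_neg.2 (hlt₀ i)).ne

lemma exists_mem_forall_lt_of_convex [Finite ι] {s : Set E} (hs : Convex ℝ s) (hne : s.Nonempty)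
    (hle : ∀ y ∈ s, ∀ i, f i y ≤ b i) (hlt : ∀ i, ∃ y ∈ s, f i y < b i) :
    ∃ y ∈ s, ∀ i, f i y < b i := by
  classical
  have := Fintype.ofFinite ι
  suffices H : ∀ t : Finset ι, ∃ y ∈ s, ∀ i ∈ t, f i y < b i by simpa using H Finset.univ
  intro t
  induction t using Finset.induction_on with
  | empty => exact hne.imp fun y hy => ⟨hy, by simp⟩
  | insert j t _ ih =>
    obtain ⟨y, hy, hyt⟩ := ih
    obtain ⟨z, hz, hzj⟩ := hlt j
    refine ⟨(1 / 2 : ℝ) • y + (1 / 2 : ℝ) • z,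
      hs hy hz (by norm_num) (by norm_num) (by norm_num), fun i hi => ?_⟩
    simp only [map_add, map_smul, smul_eq_mul]
    obtain rfl | hi := Finset.mem_insert.1 hi
    · linarith [hle y hy i]
    · linarith [hle z hz i, hyt i hi]

lemma eq_polyhedron_of_isExtreme [Finite ι] {F : Set E} (hF : IsExtreme ℝ (polyhedron U f b) F)
    (hx : x ∈ F) (hlt : ∀ i, f i x < b i) : F = polyhedron U f b := by
  refine hF.subset.antisymm fun y hy => ?_
  have hxU : x ∈ U := (hF.subset hx).1
  obtain ⟨ε, hε, hmem⟩ := exists_pos_add_smul_mem_polyhedron hxU hlt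
    (AffineSubspace.vsub_mem_direction hxU hy.1)
  refine hF.left_mem_of_mem_openSegment hy hmem hx
    ⟨ε / (1 + ε), 1 / (1 + ε), by positivity, by positivity, by field_simp; ring, ?_⟩
  rw [vsub_eq_sub]
  match_scalars <;> field_simp
  ring

end Polyhedron

section Facets

variable {E ι : Type*} [AddCommGroup E] [Module ℝ E] [TopologicalSpace E]

lemma inter_affineSpan_eq_of_isExposed {P F : Set E} (hF : IsExposed ℝ P F) :
    P ∩ affineSpan ℝ F = F := by
  refine Set.Subset.antisymm ?_ fun y hy => ⟨hF.subset hy, subset_affineSpan ℝ F hy⟩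
  rintro y ⟨hyP, hyF⟩
  obtain ⟨z, hz⟩ := (affineSpan_nonempty (k := ℝ)).1 ⟨y, hyF⟩
  obtain ⟨l, rfl⟩ := hF ⟨z, hz⟩
  have hle : affineSpan ℝ {x ∈ P | ∀ y ∈ P, l y ≤ l x} ≤ levelSubspace l.toLinearMap (l z) :=
    affineSpan_le.2 fun w hw => (hz.2 w hw.1).antisymm (hw.2 z hz.1)
  have hlyz : l y = l z := hle hyF
  exact ⟨hyP, fun w hw => hlyz ▸ hz.2 w hw⟩

lemma isExposed_setOf_eq {P : Set E} {l : StrongDual ℝ E} {c : ℝ} (hle : ∀ y ∈ P, l y ≤ c) :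
    IsExposed ℝ P {y | y ∈ P ∧ l y = c} := by
  rintro ⟨z, hzP, hzc⟩
  refine ⟨l, Set.ext fun y => and_congr_right fun hy => ⟨fun h w hw => h ▸ hle w hw, fun h => ?_⟩⟩
  exact (hle y hy).antisymm (hzc ▸ h z hzP)

lemma eq_of_isExposed_of_finrank_eq [FiniteDimensional ℝ E] {P F G : Set E}
    (hF : IsExposed ℝ P F) (hne : F.Nonempty) (hFG : F ⊆ G) (hGP : G ⊆ P)
    (hdim : Module.finrank ℝ (vectorSpan ℝ F) = Module.finrank ℝ (vectorSpan ℝ G)) : F = G := by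
  have hspan : affineSpan ℝ F = affineSpan ℝ G := by
    refine AffineSubspace.eq_of_direction_eq_of_nonempty_of_le ?_
      ((affineSpan_nonempty (k := ℝ)).2 hne) (affineSpan_mono ℝ hFG)
    rw [direction_affineSpan, direction_affineSpan]
    exact Submodule.eq_of_le_of_finrank_eq (vectorSpan_mono ℝ hFG) hdim
  refine hFG.antisymm fun y hy => ?_
  rw [← inter_affineSpan_eq_of_isExposed hF, hspan]
  exact ⟨hGP hy, subset_affineSpan ℝ G hy⟩

variable {U : AffineSubspace ℝ E} {f : ι → Module.Dual ℝ E} {b : ι → ℝ}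

lemma exists_subset_tightFace_of_isExposed [Finite ι] {F : Set E}
    (hF : IsExposed ℝ (polyhedron U f b) F) (hne : F.Nonempty) (hproper : F ≠ polyhedron U f b) :
    ∃ i, F ⊆ tightFace U f b i := by
  by_contra! hcon
  have hlt : ∀ i, ∃ y ∈ F, f i y < b i := fun i => by
    obtain ⟨y, hy, hyi⟩ := Set.not_subset.1 (hcon i)
    exact ⟨y, hy, ((hF.subset hy).2 i).lt_of_ne fun h => hyi ⟨hF.subset hy, h⟩⟩
  obtain ⟨y, hy, hylt⟩ := exists_mem_forall_lt_of_convex (hF.convex convex_polyhedron) hne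
    (fun y hy => (hF.subset hy).2) hlt
  exact hproper (eq_polyhedron_of_isExtreme hF.isExtreme hy hylt)

theorem bijOn_tightFace_facets [Finite ι] [IsTopologicalAddGroup E] [ContinuousSMul ℝ E] [T2Space E]
    [FiniteDimensional ℝ E] (h₀ : ∃ x ∈ U, ∀ i, f i x < b i)
    (h₁ : ∀ i, ∃ x ∈ U, f i x = b i ∧ ∀ j ≠ i, f j x < b j) :
    Set.BijOn (tightFace U f b) Set.univ {F | IsExposed ℝ (polyhedron U f b) F ∧ F.Nonempty ∧
      Module.finrank ℝ (vectorSpan ℝ F) + 1 =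
        Module.finrank ℝ (vectorSpan ℝ (polyhedron U f b))} := by
  obtain ⟨x₀, hx₀, hlt₀⟩ := h₀
  choose x hx heq hlt using h₁
  have hmem : ∀ i, x i ∈ tightFace U f b i := fun i => mem_tightFace (hx i) (heq i) (hlt i)
  have hdim := fun i => finrank_vectorSpan_tightFace_add_one hx₀ hlt₀ (hx i) (heq i) (hlt i)
  refine ⟨fun i _ => ⟨?_, ⟨x i, hmem i⟩, hdim i⟩, fun i _ j _ hij => ?_, ?_⟩
  · exact isExposed_setOf_eq (l := (f i).toContinuousLinearMap) fun y hy => hy.2 i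
  · by_contra hne
    have hxij : x i ∈ tightFace U f b j := hij ▸ hmem i
    exact (hlt i j (Ne.symm hne)).ne hxij.2
  · rintro F ⟨hF, hne, hFdim⟩
    obtain ⟨i, hi⟩ := exists_subset_tightFace_of_isExposed hF hne fun h => by
      rw [h] at hFdim
      omega
    refine ⟨i, trivial, (eq_of_isExposed_of_finrank_eq hF hne hi (fun y hy => hy.1) ?_).symm⟩
    have := hdim i
    omega

end Facets

theorem isMinimalIneqDescription_of_strict {n : ℕ} {ι : Type} [Finite ι]
    {U : AffineSubspace ℝ (Fin n → ℝ)} {a : ι → Fin n → ℝ} {b : ι → ℝ}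
    (h₀ : ∃ x ∈ U, ∀ i, a i ⬝ᵥ x < b i)
    (h₁ : ∀ i, ∃ x ∈ U, a i ⬝ᵥ x = b i ∧ ∀ j ≠ i, a j ⬝ᵥ x < b j) :
    IsMinimalIneqDescription (ineqSolutions U a b) U a b := by
  have hbij : Set.BijOn (fun i => {x | x ∈ ineqSolutions U a b ∧ a i ⬝ᵥ x = b i}) Set.univ
      {F | IsFacet (ineqSolutions U a b) F} :=
    bijOn_tightFace_facets (f := fun i => dotProductEquiv ℝ (Fin n) (a i)) h₀ h₁
  refine ⟨rfl, ?_, hbij⟩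
  rw [← hbij.image_eq, hbij.injOn.ncard_image, Set.ncard_univ]

lemma mem_convexHull_of_forall_exists_le {E : Type*} [AddCommGroup E] [Module ℝ E]
    [TopologicalSpace E] [IsTopologicalAddGroup E] [ContinuousSMul ℝ E] [LocallyConvexSpace ℝ E]
    [T2Space E] {s : Set E} (hs : s.Finite) {x : E}
    (h : ∀ l : StrongDual ℝ E, ∃ y ∈ s, l y ≤ l x) : x ∈ convexHull ℝ s := by
  by_contra hx
  obtain ⟨l, c, hlx, hl⟩ := geometric_hahn_banach_point_closed (convex_convexHull ℝ s)
    (hs.isClosed_convexHull ℝ) hx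
  obtain ⟨y, hy, hyx⟩ := h l
  linarith [hl y (subset_convexHull ℝ s hy)]

/-! ### Partial sums of increasing sequences -/

section PartialSum

variable {n : ℕ} {α : Fin n → ℝ}

@[simp] lemma partialSum_zero (α : Fin n → ℝ) : partialSum α 0 = 0 := by simp [partialSum]

@[simp] lemma partialSum_self (α : Fin n → ℝ) : partialSum α n = ∑ i, α i := by simp [partialSum]

lemma partialSum_succ (α : Fin n → ℝ) {t : ℕ} (ht : t < n) :
    partialSum α (t + 1) = partialSum α t + α ⟨t, ht⟩ := by
  have : (Finset.univ.filter fun k : Fin n => k.val < t + 1) =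
      insert ⟨t, ht⟩ (Finset.univ.filter fun k : Fin n => k.val < t) := by
    ext k
    simp only [Finset.mem_filter, Finset.mem_univ, true_and, Finset.mem_insert, Fin.ext_iff]
    omega
  rw [partialSum, this, Finset.sum_insert (by simp), add_comm, partialSum]

lemma sum_filter_le_val (α : Fin n → ℝ) (t : ℕ) :
    ∑ i : Fin n with t ≤ i.val, α i = ∑ i, α i - partialSum α t := by
  rw [partialSum, ← Finset.sum_filter_add_sum_filter_not Finset.univ (fun k : Fin n => k.val < t)]
  simp

lemma partialSum_add_sub_mono (hα : Monotone α) {a b k : ℕ} (hab : a ≤ b) (hb : b + k ≤ n) :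
    partialSum α (a + k) - partialSum α a ≤ partialSum α (b + k) - partialSum α b := by
  induction k with
  | zero => simp
  | succ k ih =>
    rw [← add_assoc, ← add_assoc, partialSum_succ α (by omega : a + k < n),
      partialSum_succ α (by omega : b + k < n)]
    have hle : α ⟨a + k, by omega⟩ ≤ α ⟨b + k, by omega⟩ := hα (Fin.mk_le_mk.2 (by omega))
    linarith [ih (by omega)]

lemma partialSum_supermodular (hα : Monotone α) {p q p₀ q₀ : ℕ} (hp : p₀ ≤ p) (hq : q₀ ≤ q)
    (h : p + 1 + q ≤ n) :
    partialSum α (p₀ + 1 + q₀) + partialSum α p + partialSum α q ≤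
      partialSum α (p + 1 + q) + partialSum α p₀ + partialSum α q₀ := by
  have hleft := partialSum_add_sub_mono hα (k := 1 + q₀) hp (by omega)
  have hright := partialSum_add_sub_mono hα (k := 1 + p) hq (by omega)
  rw [← add_assoc, ← add_assoc] at hleft
  rw [show q₀ + (1 + p) = p + 1 + q₀ by omega, show q + (1 + p) = p + 1 + q by omega] at hright
  linarith

lemma partialSum_add_le {c : ℝ} {a k : ℕ} (hk : a + k ≤ n)
    (h : ∀ i : Fin n, i.val < a + k → α i ≤ c) :
    partialSum α (a + k) ≤ partialSum α a + k * c := by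
  induction k with
  | zero => simp
  | succ k ih =>
    rw [← add_assoc, partialSum_succ α (by omega : a + k < n), Nat.cast_succ]
    linarith [ih (by omega) fun i hi => h i (by omega), h ⟨a + k, hk⟩ (by simp)]

lemma le_partialSum_add {c : ℝ} {a k : ℕ} (hk : a + k ≤ n) (h : ∀ i : Fin n, a ≤ i.val → c ≤ α i) :
    partialSum α a + k * c ≤ partialSum α (a + k) := by
  induction k with
  | zero => simp
  | succ k ih =>
    rw [← add_assoc, partialSum_succ α (by omega : a + k < n), Nat.cast_succ]
    linarith [ih (by omega), h ⟨a + k, hk⟩ (by simp)]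

lemma partialSum_lt_chord (hα : StrictMono α) {a b c : ℕ} (hab : a < b) (hbc : b < c)
    (hc : c ≤ n) :
    ((c : ℝ) - a) * partialSum α b <
      ((c : ℝ) - b) * partialSum α a + ((b : ℝ) - a) * partialSum α c := by
  obtain ⟨k, rfl⟩ := Nat.exists_eq_add_of_lt hab
  obtain ⟨m, rfl⟩ := Nat.exists_eq_add_of_lt hbc
  have hlow := partialSum_add_le (α := α) (a := a) (k := k + 1) (c := α ⟨a + k, by omega⟩)
    (by omega) fun i hi => hα.monotone (Fin.le_def.2 (by simp only; omega))
  have hhigh := le_partialSum_add (α := α) (a := a + k + 1) (k := m + 1)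
    (c := α ⟨a + k + 1, by omega⟩) hc fun i hi => hα.monotone (Fin.le_def.2 hi)
  have hstep : α ⟨a + k, by omega⟩ < α ⟨a + k + 1, by omega⟩ := hα (Fin.mk_lt_mk.2 (by omega))
  simp only [← add_assoc] at hlow hhigh
  push_cast at hlow hhigh ⊢
  nlinarith [mul_le_mul_of_nonneg_left hlow (by positivity : (0 : ℝ) ≤ m + 1),
    mul_le_mul_of_nonneg_left hhigh (by positivity : (0 : ℝ) ≤ k + 1),
    mul_lt_mul_of_pos_left hstep (by positivity : (0 : ℝ) < (m + 1) * (k + 1))]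

end PartialSum

/-! ### Coordinates of the tree points -/

section TreeCoord

variable {n : ℕ}

/-- The coordinates of `v_T^α`, with labels starting from `0`, for a tree `T` of any size: the
subtrees of a tree with `n` internal vertices are smaller, but are valued by the same `α`. -/
def treeCoord (α : Fin n → ℝ) (T : BinaryTree Unit) (i : ℕ) : ℝ :=
  treeVal α (subtreeAt T (i + 1))

lemma numNodes_node (u : Unit) (l r : BinaryTree Unit) :
    (BinaryTree.node u l r).numNodes = l.numNodes + 1 + r.numNodes := by
  rw [BinaryTree.numNodes, add_right_comm]

variable (α : Fin n → ℝ) (u : Unit) (l r : BinaryTree Unit)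

lemma treeCoord_node_of_lt {i : ℕ} (hi : i < l.numNodes) :
    treeCoord α (.node u l r) i = treeCoord α l i := by
  rw [treeCoord, subtreeAt, if_pos (by rw [l.numLeaves_eq_numNodes_succ]; omega), treeCoord]

lemma treeCoord_node_numNodes :
    treeCoord α (.node u l r) l.numNodes = partialSum α (l.numNodes + 1 + r.numNodes) -
      partialSum α l.numNodes - partialSum α r.numNodes := by
  rw [treeCoord, subtreeAt, if_neg (by rw [l.numLeaves_eq_numNodes_succ]; omega),
    if_neg (by rw [l.numLeaves_eq_numNodes_succ]; omega), treeVal, numNodes_node,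
    BinaryTree.left, BinaryTree.right]

lemma treeCoord_node_add (i : ℕ) :
    treeCoord α (.node u l r) (l.numNodes + 1 + i) = treeCoord α r i := by
  rw [treeCoord, subtreeAt, if_neg (by rw [l.numLeaves_eq_numNodes_succ]; omega),
    if_pos (by rw [l.numLeaves_eq_numNodes_succ]; omega), l.numLeaves_eq_numNodes_succ,
    add_assoc, Nat.add_sub_cancel_left, treeCoord]

lemma sum_range_mul_treeCoord_node {a j : ℕ} (hl : l.numNodes = a + j) (s : ℕ) (g : ℕ → ℝ) :
    ∑ i ∈ Finset.range (j + 1 + s), g i * treeCoord α (.node u l r) (a + i) =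
      ∑ i ∈ Finset.range j, g i * treeCoord α l (a + i) +
        g j * (partialSum α (l.numNodes + 1 + r.numNodes) - partialSum α l.numNodes -
          partialSum α r.numNodes) +
        ∑ i ∈ Finset.range s, g (j + 1 + i) * treeCoord α r i := by
  rw [Finset.sum_range_add, Finset.sum_range_succ, ← treeCoord_node_numNodes α u, ← hl]
  congr 2
  · refine Finset.sum_congr rfl fun i hi => ?_
    rw [treeCoord_node_of_lt α u l r (by have := Finset.mem_range.1 hi; omega)]
  · refine funext fun i => ?_
    rw [show a + (j + 1 + i) = l.numNodes + 1 + i by omega, treeCoord_node_add]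

lemma sum_range_treeCoord (T : BinaryTree Unit) :
    ∑ i ∈ Finset.range T.numNodes, treeCoord α T i = partialSum α T.numNodes := by
  induction T with
  | nil => simp
  | node u l r hl hr =>
    have hsplit := sum_range_mul_treeCoord_node α u l r (zero_add _).symm r.numNodes 1
    simp only [Pi.one_apply, one_mul, zero_add] at hsplit
    rw [numNodes_node, hsplit, hl, hr]
    ring

variable {α}

lemma partialSum_le_sum_treeCoord (hα : Monotone α) (T : BinaryTree Unit) (hT : T.numNodes ≤ n)
    {a k : ℕ} (hk : a + k ≤ T.numNodes) :
    partialSum α k ≤ ∑ i ∈ Finset.range k, treeCoord α T (a + i) := by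
  induction T generalizing a k with
  | nil =>
    obtain rfl : k = 0 := by rw [BinaryTree.numNodes] at hk; omega
    simp
  | node u l r hl hr =>
    rw [numNodes_node] at hT hk
    by_cases hleft : a + k ≤ l.numNodes
    · rw [Finset.sum_congr rfl fun i hi => treeCoord_node_of_lt α u l r
        (by have := Finset.mem_range.1 hi; omega)]
      exact hl (by omega) hleft
    by_cases hright : l.numNodes + 1 ≤ a
    · obtain ⟨a, rfl⟩ := Nat.exists_eq_add_of_le hright
      simp only [add_assoc _ a, treeCoord_node_add]
      exact hr (by omega) (by omega)
    · obtain ⟨j, hj⟩ := Nat.exists_eq_add_of_le (by omega : a ≤ l.numNodes)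
      obtain ⟨s, rfl⟩ := Nat.exists_eq_add_of_le (by omega : j + 1 ≤ k)
      have hsplit := sum_range_mul_treeCoord_node α u l r hj s 1
      simp only [Pi.one_apply, one_mul] at hsplit
      have hsuper := partialSum_supermodular hα (by omega : j ≤ l.numNodes)
        (by omega : s ≤ r.numNodes) hT
      have hr₀ := hr (a := 0) (k := s) (by omega) (by omega)
      simp only [zero_add] at hr₀
      rw [hsplit]
      linarith [hl (by omega) hj.ge]

variable (α)

lemma sum_mul_treeCoord_node_le {g x : ℕ → ℝ} (hg : g l.numNodes = 0)
    (hl : ∑ i ∈ Finset.range l.numNodes, g i * treeCoord α l i ≤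
      ∑ i ∈ Finset.range l.numNodes, g i * x i)
    (hr : ∑ i ∈ Finset.range r.numNodes, g (l.numNodes + 1 + i) * treeCoord α r i ≤
      ∑ i ∈ Finset.range r.numNodes, g (l.numNodes + 1 + i) * x (l.numNodes + 1 + i)) :
    ∑ i ∈ Finset.range (l.numNodes + 1 + r.numNodes), g i * treeCoord α (.node u l r) i ≤
      ∑ i ∈ Finset.range (l.numNodes + 1 + r.numNodes), g i * x i := by
  have hsplit := sum_range_mul_treeCoord_node α u l r (zero_add _).symm r.numNodes g
  simp only [zero_add] at hsplit
  rw [hsplit, Finset.sum_range_add, Finset.sum_range_succ, hg, zero_mul, zero_mul]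
  exact add_le_add (add_le_add hl le_rfl) hr

/-- Subtracting a lower bound `s` of the costs amounts to adding `s` times the excess of the total
of `x` over the total of `v_T^α`; the recursion needs it since only the inequality between the
totals is inherited by the two sides of the root. -/
lemma exists_sum_mul_treeCoord_le (m : ℕ) (c x : ℕ → ℝ)
    (hx : ∀ a k, a + k ≤ m → partialSum α k ≤ ∑ i ∈ Finset.range k, x (a + i)) :
    ∃ T : BinaryTree Unit, T.numNodes = m ∧ ∀ s : ℝ, (∀ i < m, s ≤ c i) →
      ∑ i ∈ Finset.range m, (c i - s) * treeCoord α T i ≤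
        ∑ i ∈ Finset.range m, (c i - s) * x i := by
  induction m using Nat.strong_induction_on generalizing c x with
  | _ m ih =>
  obtain rfl | hm := m.eq_zero_or_pos
  · exact ⟨.nil, rfl, by simp⟩
  obtain ⟨p, hp, hmin⟩ := Finset.exists_min_image (Finset.range m) c ⟨0, by simpa⟩
  simp only [Finset.mem_range] at hp hmin
  obtain ⟨q, rfl⟩ := Nat.exists_eq_add_of_le hp
  obtain ⟨l, rfl, hl⟩ := ih p hp c x fun a k hk => hx a k (by omega)
  obtain ⟨r, rfl, hr⟩ := ih q (by omega) (fun i => c (l.numNodes + 1 + i))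
    (fun i => x (l.numNodes + 1 + i)) fun a k hk => by
      simp only [← add_assoc]
      exact hx (l.numNodes + 1 + a) k (by omega)
  refine ⟨.node () l r, numNodes_node _ _ _, fun s hs => ?_⟩
  set c₀ := c l.numNodes
  have hroot : ∑ i ∈ Finset.range (l.numNodes + 1 + r.numNodes),
        (c i - c₀) * treeCoord α (.node () l r) i ≤
      ∑ i ∈ Finset.range (l.numNodes + 1 + r.numNodes), (c i - c₀) * x i := by
    refine sum_mul_treeCoord_node_le α () l r (sub_self _) ?_ ?_
    · exact hl c₀ fun i hi => hmin i (by omega)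
    · exact hr c₀ fun i hi => hmin _ (by omega)
  have htotal : ∑ i ∈ Finset.range (l.numNodes + 1 + r.numNodes), treeCoord α (.node () l r) i ≤
      ∑ i ∈ Finset.range (l.numNodes + 1 + r.numNodes), x i := by
    rw [← numNodes_node (), sum_range_treeCoord, numNodes_node]
    simpa only [zero_add] using hx 0 _ (zero_add _).le
  have hshift : ∀ y : ℕ → ℝ, ∑ i ∈ Finset.range (l.numNodes + 1 + r.numNodes), (c i - s) * y i =
      (c₀ - s) * ∑ i ∈ Finset.range (l.numNodes + 1 + r.numNodes), y i +
        ∑ i ∈ Finset.range (l.numNodes + 1 + r.numNodes), (c i - c₀) * y i := fun y => by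
    rw [Finset.mul_sum, ← Finset.sum_add_distrib]
    exact Finset.sum_congr rfl fun i _ => by ring
  rw [hshift, hshift x]
  have := sub_nonneg.2 (hs _ hp)
  gcongr

end TreeCoord

/-! ### The inequality description -/

section IntervalPolytope

variable {n : ℕ} {α x : Fin n → ℝ}

/-- The points of the hyperplane of `α` that satisfy the inequalities of all proper intervals. It
turns out to be `LodAsso α`. -/
def intervalPolytope (α : Fin n → ℝ) : Set (Fin n → ℝ) :=
  ineqSolutions (sumHyperplane α) (fun I : ProperInterval n => indicatorVec (I.val)ᶜ)
    (fun I : ProperInterval n => ∑ i : Fin n with I.val.card ≤ i.val, α i)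

lemma indicatorVec_dotProduct (S : Finset (Fin n)) (x : Fin n → ℝ) :
    indicatorVec S ⬝ᵥ x = ∑ i ∈ S, x i := by
  rw [indicatorVec, sum_dotProduct]
  simp

lemma mem_sumHyperplane : x ∈ sumHyperplane α ↔ ∑ i, x i = ∑ i, α i := by
  rw [← one_dotProduct]; rfl

lemma indicatorVec_compl_dotProduct_sub (hx : x ∈ sumHyperplane α) (I : Finset (Fin n)) :
    indicatorVec Iᶜ ⬝ᵥ x - ∑ i : Fin n with I.card ≤ i.val, α i =
      partialSum α I.card - ∑ i ∈ I, x i := by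
  rw [indicatorVec_dotProduct, sum_filter_le_val, ← mem_sumHyperplane.1 hx,
    ← Finset.sum_add_sum_compl I x]
  ring

lemma mem_intervalPolytope : x ∈ intervalPolytope α ↔ x ∈ sumHyperplane α ∧
    ∀ I : ProperInterval n, partialSum α I.val.card ≤ ∑ i ∈ I.val, x i :=
  and_congr_right fun hx => forall_congr' fun I => by
    rw [← sub_nonpos, indicatorVec_compl_dotProduct_sub hx, sub_nonpos]

lemma convex_intervalPolytope (α : Fin n → ℝ) : Convex ℝ (intervalPolytope α) :=
  convex_polyhedron (U := levelSubspace (dotProductEquiv ℝ (Fin n) 1) (∑ i, α i))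
    (f := fun I : ProperInterval n => dotProductEquiv ℝ (Fin n) (indicatorVec (I.val)ᶜ))

lemma sum_Icc_fin (X : ℕ → ℝ) (a b : Fin n) :
    ∑ i ∈ Finset.Icc a b, X i = ∑ i ∈ Finset.range (b + 1 - a), X (a + i) := by
  have hmap : Finset.Ico a.val (b.val + 1) = (Finset.Icc a b).map Fin.valEmbedding := by
    rw [Fin.map_valEmbedding_Icc]
    ext k
    simp only [Finset.mem_Ico, Finset.mem_Icc]
    omega
  rw [← Finset.sum_Ico_eq_sum_range, hmap, Finset.sum_map]
  rfl

lemma sum_lodayVertex (α : Fin n → ℝ) {T : BinaryTree Unit} (hT : T.numNodes = n) :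
    ∑ i, lodayVertex α T i = ∑ i, α i := by
  have hsum := sum_range_treeCoord α T
  rw [hT, partialSum_self] at hsum
  exact (Fin.sum_univ_eq_sum_range (treeCoord α T) n).trans hsum

lemma lodayVertex_mem_intervalPolytope (hα : Monotone α) {T : BinaryTree Unit}
    (hT : T.numNodes = n) : lodayVertex α T ∈ intervalPolytope α := by
  rw [mem_intervalPolytope, mem_sumHyperplane]
  refine ⟨sum_lodayVertex α hT, ?_⟩
  rintro ⟨_, ⟨a, b, rfl⟩, hne, -⟩
  have hab : a ≤ b := Finset.nonempty_Icc.1 hne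
  rw [Fin.card_Icc]
  exact (partialSum_le_sum_treeCoord hα T hT.le (by omega)).trans_eq
    (sum_Icc_fin (treeCoord α T) a b).symm

lemma partialSum_le_sum_extend (hx : x ∈ intervalPolytope α) {a k : ℕ} (hk : a + k ≤ n) :
    partialSum α k ≤ ∑ i ∈ Finset.range k, Function.extend Fin.val x 0 (a + i) := by
  have hext : ∀ i : Fin n, Function.extend Fin.val x 0 i = x i := Fin.val_injective.extend_apply x 0
  rw [mem_intervalPolytope, mem_sumHyperplane] at hx
  obtain rfl | hpos := k.eq_zero_or_pos
  · simp
  obtain rfl | hkn := (by omega : k ≤ n).eq_or_lt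
  · obtain rfl : a = 0 := by omega
    simp only [zero_add, ← Fin.sum_univ_eq_sum_range, hext, hx.1, partialSum_self, le_refl]
  · let I : Finset (Fin n) := Finset.Icc ⟨a, by omega⟩ ⟨a + k - 1, by omega⟩
    have hcard : I.card = k := by
      simp only [I, Fin.card_Icc]
      omega
    have hI : I ≠ Finset.univ := by
      rw [← Finset.card_lt_iff_ne_univ, hcard, Fintype.card_fin]
      exact hkn
    have hle := hx.2 ⟨I, ⟨_, _, rfl⟩, Finset.card_pos.1 (hcard ▸ hpos), hI⟩
    simp only [hcard, ← hext] at hle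
    rwa [sum_Icc_fin, show a + k - 1 + 1 - a = k by omega] at hle

lemma exists_dotProduct_lodayVertex_le (hx : x ∈ intervalPolytope α) (c : Fin n → ℝ) :
    ∃ T : BinaryTree Unit, T.numNodes = n ∧ c ⬝ᵥ lodayVertex α T ≤ c ⬝ᵥ x := by
  have hext : ∀ (y : Fin n → ℝ) (i : Fin n), Function.extend Fin.val y 0 i = y i := fun y =>
    Fin.val_injective.extend_apply y 0
  obtain ⟨T, hT, hcost⟩ := exists_sum_mul_treeCoord_le α n (Function.extend Fin.val c 0)
    (Function.extend Fin.val x 0) fun a k => partialSum_le_sum_extend hx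
  obtain ⟨s, hs⟩ := (Set.finite_range c).bddBelow
  have hle := hcost s fun i hi => hext c ⟨i, hi⟩ ▸ hs ⟨⟨i, hi⟩, rfl⟩
  have hsum : ∀ Y : ℕ → ℝ, ∑ i ∈ Finset.range n, (Function.extend Fin.val c 0 i - s) * Y i =
      ∑ i : Fin n, c i * Y i - s * ∑ i : Fin n, Y i := fun Y => by
    rw [← Fin.sum_univ_eq_sum_range fun i => (Function.extend Fin.val c 0 i - s) * Y i]
    simp only [hext, sub_mul, Finset.sum_sub_distrib, ← Finset.mul_sum]
  have htotal : ∑ i : Fin n, treeCoord α T i = ∑ i, x i :=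
    (sum_lodayVertex α hT).trans (mem_sumHyperplane.1 hx.1).symm
  rw [hsum, hsum, htotal] at hle
  simp only [hext, sub_le_sub_iff_right] at hle
  exact ⟨T, hT, hle⟩

theorem LodAsso_eq_intervalPolytope (hα : Monotone α) : LodAsso α = intervalPolytope α := by
  refine Set.Subset.antisymm (convexHull_min ?_ (convex_intervalPolytope α)) fun x hx => ?_
  · rintro _ ⟨T, hT, rfl⟩
    exact lodayVertex_mem_intervalPolytope hα hT
  · have hfin : {v | ∃ T : BinaryTree Unit, T.numNodes = n ∧ v = lodayVertex α T}.Finite := by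
      refine ((BinaryTree.treesOfNumNodesEq n).finite_toSet.image (lodayVertex α)).subset ?_
      rintro _ ⟨T, hT, rfl⟩
      exact ⟨T, by simpa using hT, rfl⟩
    refine mem_convexHull_of_forall_exists_le hfin fun l => ?_
    obtain ⟨c, hc⟩ := (dotProductEquiv ℝ (Fin n)).surjective l.toLinearMap
    obtain ⟨T, hT, hle⟩ := exists_dotProduct_lodayVertex_le hx c
    have hl : ∀ y, l y = c ⬝ᵥ y := fun y => (LinearMap.congr_fun hc y).symm
    exact ⟨lodayVertex α T, ⟨T, hT, rfl⟩, by rwa [hl, hl]⟩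

end IntervalPolytope

/-! ### Points with prescribed tight inequalities -/

section BlockAverage

variable {n : ℕ} {α : Fin n → ℝ}

/-- The mean of the first `m` entries of `α`; it is `0` for `m = 0`. -/
noncomputable def headMean (α : Fin n → ℝ) (m : ℕ) : ℝ :=
  partialSum α m / m

/-- The mean of the entries of `α` after the first `m`; it is `0` for `m = n`. -/
noncomputable def tailMean (α : Fin n → ℝ) (m : ℕ) : ℝ :=
  (partialSum α n - partialSum α m) / (n - m)

lemma mul_headMean (α : Fin n → ℝ) (m : ℕ) : m * headMean α m = partialSum α m := by
  obtain rfl | hm := m.eq_zero_or_pos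
  · simp
  · rw [headMean]
    field_simp

lemma mul_tailMean (α : Fin n → ℝ) (m : ℕ) :
    ((n : ℝ) - m) * tailMean α m = partialSum α n - partialSum α m := by
  obtain rfl | hm := eq_or_ne m n
  · simp
  · have : (n : ℝ) - m ≠ 0 := sub_ne_zero.2 (by exact_mod_cast hm.symm)
    rw [tailMean]
    field_simp

lemma partialSum_lt_mul_headMean (hα : StrictMono α) {k m : ℕ} (hk : 0 < k) (hkm : k < m)
    (hm : m ≤ n) : partialSum α k < k * headMean α m := by
  have hchord := partialSum_lt_chord hα hk hkm hm
  simp only [Nat.cast_zero, sub_zero, partialSum_zero, mul_zero, zero_add,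
    ← mul_headMean α m] at hchord
  have hm₀ : (0 : ℝ) < m := by exact_mod_cast hk.trans hkm
  exact lt_of_mul_lt_mul_left (hchord.trans_eq (by ring)) hm₀.le

lemma partialSum_lt_add_mul_tailMean (hα : StrictMono α) {k m : ℕ} (hmk : m < k) (hk : k < n) :
    partialSum α k < partialSum α m + (k - m) * tailMean α m := by
  have hchord := partialSum_lt_chord hα hmk hk le_rfl
  rw [← add_sub_cancel (partialSum α m) (partialSum α n), ← mul_tailMean] at hchord
  have hmn : (0 : ℝ) < n - m := sub_pos.2 (by exact_mod_cast hmk.trans hk)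
  exact lt_of_mul_lt_mul_left (hchord.trans_eq (by ring)) hmn.le

lemma headMean_lt_tailMean (hα : StrictMono α) {m : ℕ} (hm : 0 < m) (hmn : m < n) :
    headMean α m < tailMean α m := by
  have hhead := partialSum_lt_mul_headMean hα hm hmn le_rfl
  have hn := mul_headMean α n
  have htail := mul_tailMean α m
  have hm₀ : (0 : ℝ) < m := by exact_mod_cast hm
  have hmn₀ : (0 : ℝ) < n - m := sub_pos.2 (by exact_mod_cast hmn)
  rw [← mul_headMean α m] at hhead htail
  have := lt_of_mul_lt_mul_left hhead hm₀.le
  nlinarith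

/-- The point obtained from `α` by averaging its first `|I|` entries over the places in `I`, and
its remaining entries over the other places. -/
noncomputable def blockAverage (α : Fin n → ℝ) (I : Finset (Fin n)) : Fin n → ℝ :=
  fun i => if i ∈ I then headMean α I.card else tailMean α I.card

lemma sum_blockAverage (α : Fin n → ℝ) (I J : Finset (Fin n)) :
    ∑ i ∈ J, blockAverage α I i =
      (J ∩ I).card * headMean α I.card + (J \ I).card * tailMean α I.card := by
  simp only [blockAverage]
  rw [Finset.sum_ite, Finset.filter_mem_eq_inter, Finset.filter_notMem_eq_sdiff]
  simp

lemma sum_blockAverage_self (α : Fin n → ℝ) (I : Finset (Fin n)) :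
    ∑ i ∈ I, blockAverage α I i = partialSum α I.card := by
  simp [sum_blockAverage, mul_headMean]

lemma blockAverage_mem_sumHyperplane (α : Fin n → ℝ) (I : Finset (Fin n)) :
    blockAverage α I ∈ sumHyperplane α := by
  have hIn : I.card ≤ n := I.card_le_univ.trans_eq (Fintype.card_fin n)
  rw [mem_sumHyperplane, sum_blockAverage, Finset.univ_inter, ← Finset.compl_eq_univ_sdiff,
    Finset.card_compl, Fintype.card_fin, Nat.cast_sub hIn, mul_headMean, mul_tailMean,
    partialSum_self, add_sub_cancel]

lemma partialSum_card_lt_sum_blockAverage (hα : StrictMono α) {I J : Finset (Fin n)}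
    (hI : I.Nonempty) (hJ : J.Nonempty) (hJu : J ≠ Finset.univ) (hJI : J ≠ I) :
    partialSum α J.card < ∑ i ∈ J, blockAverage α I i := by
  have hIn : I.card ≤ n := I.card_le_univ.trans_eq (Fintype.card_fin n)
  have hJn : J.card < n := by simpa using (Finset.card_lt_iff_ne_univ J).2 hJu
  have hcard : ((J ∩ I).card : ℝ) + (J \ I).card = J.card := by
    exact_mod_cast Finset.card_inter_add_card_sdiff J I
  have hinter : ((J ∩ I).card : ℝ) ≤ I.card := by
    exact_mod_cast Finset.card_le_card Finset.inter_subset_right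
  rw [sum_blockAverage]
  obtain hIJ | hle := lt_or_ge I.card J.card
  · have hmean := headMean_lt_tailMean hα hI.card_pos (hIJ.trans hJn)
    calc partialSum α J.card < partialSum α I.card + (J.card - I.card) * tailMean α I.card :=
          partialSum_lt_add_mul_tailMean hα hIJ hJn
      _ ≤ _ := by
          rw [← mul_headMean, ← hcard]
          nlinarith
  by_cases hsub : J ⊆ I
  · have hlt : J.card < I.card := Finset.card_lt_card (hsub.ssubset_of_ne hJI)
    simpa [Finset.inter_eq_left.2 hsub, Finset.sdiff_eq_empty_iff_subset.2 hsub] using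
      partialSum_lt_mul_headMean hα hJ.card_pos hlt hIn
  · have hIu : I ≠ Finset.univ := by
      rintro rfl
      exact hsub J.subset_univ
    have hmean := headMean_lt_tailMean hα hI.card_pos
      (by simpa using (Finset.card_lt_iff_ne_univ I).2 hIu)
    have hsdiff : (0 : ℝ) < (J \ I).card := by
      exact_mod_cast Finset.card_pos.2 (Finset.sdiff_nonempty.2 hsub)
    calc partialSum α J.card ≤ J.card * headMean α I.card := by
          obtain heq | hlt := hle.eq_or_lt
          · rw [heq, mul_headMean]
          · exact (partialSum_lt_mul_headMean hα hJ.card_pos hlt hIn).le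
      _ < _ := by
          rw [← hcard]
          nlinarith

lemma indicatorVec_compl_dotProduct_blockAverage_lt (hα : StrictMono α) {I J : Finset (Fin n)}
    (hI : I.Nonempty) (hJ : J.Nonempty) (hJu : J ≠ Finset.univ) (hJI : J ≠ I) :
    indicatorVec Jᶜ ⬝ᵥ blockAverage α I < ∑ i : Fin n with J.card ≤ i.val, α i := by
  rw [← sub_neg, indicatorVec_compl_dotProduct_sub (blockAverage_mem_sumHyperplane α I), sub_neg]
  exact partialSum_card_lt_sum_blockAverage hα hI hJ hJu hJI

lemma indicatorVec_compl_dotProduct_blockAverage_self (α : Fin n → ℝ) (I : Finset (Fin n)) :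
    indicatorVec Iᶜ ⬝ᵥ blockAverage α I = ∑ i : Fin n with I.card ≤ i.val, α i := by
  rw [← sub_eq_zero, indicatorVec_compl_dotProduct_sub (blockAverage_mem_sumHyperplane α I),
    sum_blockAverage_self, sub_self]

end BlockAverage

/-- In the right-hand sides, `∑_{i=|I|+1}^{d+1} α_i` is the sum over the elements of
`Fin (d + 1)` whose value is at least `|I|`. -/
theorem theorem4p11 (d : ℕ) (α : Fin (d + 1) → ℝ) (hα : StrictMono α) :
    IsMinimalIneqDescription (LodAsso α) (sumHyperplane α)
      (fun I : ProperInterval (d + 1) => indicatorVec (I.val)ᶜ)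
      (fun I : ProperInterval (d + 1) =>
        ∑ i : Fin (d + 1) with I.val.card ≤ i.val, α i) := by
  rw [LodAsso_eq_intervalPolytope hα.monotone]
  refine isMinimalIneqDescription_of_strict
    (U := levelSubspace (dotProductEquiv ℝ (Fin (d + 1)) 1) (∑ i, α i)) ?_ ?_
  · exact ⟨blockAverage α Finset.univ, blockAverage_mem_sumHyperplane α _, fun J =>
      indicatorVec_compl_dotProduct_blockAverage_lt hα Finset.univ_nonempty J.2.2.1 J.2.2.2
        J.2.2.2⟩
  · exact fun I => ⟨blockAverage α I, blockAverage_mem_sumHyperplane α _,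
      indicatorVec_compl_dotProduct_blockAverage_self α _, fun J hJI =>
      indicatorVec_compl_dotProduct_blockAverage_lt hα I.2.2.1 J.2.2.1 J.2.2.2
        (Subtype.coe_ne_coe.2 hJI)⟩
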